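/- Let \(K\) be an infinite field and let \(A\) be a finite-dimensional \(K\)-algebra which is pointed (every simple left \(A\)-module is one-dimensional over \(K\)) and acyclic (the Ext quiver of \(A\), whose vertices are the isomorphism classes of simple modules, with an arrow between \(S\) and \(T\) whenever \(\mathrm{Ext}^1_A(S,T)\neq 0\), has no oriented cycles, loops included). Let \(M\) be a left \(A\)-module. Then the following are equivalent: \(M\) is distributive, i.e. \(X\cap(Y+Z)=(X\cap Y)+(X\cap Z)\) for all submodules \(X,Y,Z\) of \(M\); \(M\) has only finitely many submodules; the group of units of \(A\) has only finitely many orbits on \(M\). Suppose that \(M\) is distributive and put \(B=A/\mathrm{ann}(M)\), acting on \(M\). For a finite poset \(P\), let \(I(P,K)\) be the incidence algebra of all functions \(g:P\times P\to K\) with \(g(x,y)=0\) unless \(x\le y\), under convolution. Its standard basis consists of the functions \(f_{xy}\) (\(x\le y\)) that are \(1\) at \((x,y)\) and \(0\) elsewhere, and its defining representation is its action, as matrices, on the column vectors \(K^P\). (1) There are a finite poset \(P\), an isomorphism of \(K\)-algebras \(B\cong I(P,K)\), a \(K\)-basis \((f_{xy})_{x\le y}\) of \(B\) that corresponds under this isomorphism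 to the standard basis of \(I(P,K)\), and a \(K\)-basis \((m_x)_{x\in P}\) of \(M\), with respect to which \(M\) is the defining representation: \(f_{xy}\cdot m_y=m_x\) for \(x\le y\), and \(f_{xy}\cdot m_z=0\) for \(z\neq y\). (2) For every finite poset \(P\) and every isomorphism of \(K\)-algebras \(\psi:B\to I(P,K)\) there is an algebra automorphism \(\varphi\) of \(B\) such that the twisted module \({}_\varphi M\) (the space \(M\), on which \(b\in B\) acts as \(\varphi(b)\)) is isomorphic to the defining representation of \(I(P,K)\), regarded as a \(B\)-module through \(\psi\). -/

import Mathlib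

universe u v w x

/-- An algebra `A` over a field `K` is (basic) pointed if every simple left `A`-module is
one-dimensional over `K`. For finite-dimensional `A` this says that `A` modulo its Jacobson radical
is a product of copies of `K`, so that `A` is automatically basic. -/
def IsPointedAlgebra (K : Type w) [Field K] (A : Type u) [Ring A] [Algebra K A] : Prop :=
  ∀ (S : Type u) [AddCommGroup S] [Module K S] [Module A S] [IsScalarTower K A S]
    [IsSimpleModule A S], Module.finrank K S = 1

/-- There is an arrow between (the classes of) the `A`-modules `S` and `T` in the Ext quiver of `A`:
both are simple, and `Ext¹_A(S, T) ≠ 0`. -/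
def ExtArrow {A : Type u} [Ring A] (S T : ModuleCat.{u} A) : Prop :=
  IsSimpleModule A S ∧ IsSimpleModule A T ∧
    Nontrivial (CategoryTheory.Abelian.Ext.{u} S T 1)

/-- The ring `A` is acyclic if its Ext quiver has no oriented cycle (loops included). Since
`ExtArrow` is invariant under isomorphism, it does not matter whether the vertices are taken to be
the simple modules or their isomorphism classes. -/
def IsAcyclicAlgebra (A : Type u) [Ring A] : Prop :=
  ∀ S : ModuleCat.{u} A, ¬ Relation.TransGen ExtArrow S S

/-- A module is distributive if its lattice of submodules is a distributive lattice. -/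
def IsDistributiveModule (A : Type u) (M : Type v) [Ring A] [AddCommGroup M] [Module A M] : Prop :=
  ∀ X Y Z : Submodule A M, X ⊓ (Y ⊔ Z) = (X ⊓ Y) ⊔ (X ⊓ Z)

namespace IncidenceAlgebra

section

variable (K : Type w) [Field K] {P : Type x} [PartialOrder P]

/-- The standard basis element `f_{xy}` of the incidence algebra, for `x ≤ y`: it is the function
with value `1` at `(x, y)` and `0` elsewhere. -/
def elementary [DecidableEq P] (a b : P) (hab : a ≤ b) : IncidenceAlgebra K P where
  toFun c d := if c = a ∧ d = b then 1 else 0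
  eq_zero_of_not_le' c d hcd := by
    rw [if_neg]
    rintro ⟨rfl, rfl⟩
    exact hcd hab

end

section

variable (K : Type w) [Field K] (P : Type x) [PartialOrder P] [Fintype P] [DecidableEq P]
  [LocallyFiniteOrder P]

/-- The defining representation of the incidence algebra of a finite poset `P`, on the column
vectors `P → K`, an element of the algebra being viewed as a `P × P` matrix. -/
def definingRep : IncidenceAlgebra K P →ₐ[K] Module.End K (P → K) :=
  AlgHom.ofLinearMap
    { toFun := fun g => Matrix.toLin' (Matrix.of fun a b => g a b)
      map_add' := fun g h => by
        rw [← map_add]; rfl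
      map_smul' := fun c g => by
        rw [RingHom.id_apply, ← map_smul]; rfl }
    (by
      refine Eq.trans ?_ Matrix.toLin'_one
      exact congrArg Matrix.toLin' (by ext a b; simp [Matrix.one_apply]))
    (fun g h => by
      refine Eq.trans ?_ (Matrix.toLin'_mul _ _)
      refine congrArg Matrix.toLin' ?_
      ext a b
      simp only [Matrix.of_apply, Matrix.mul_apply, mul_apply]
      refine Finset.sum_subset (Finset.subset_univ _) fun c _ hc => ?_
      rw [Finset.mem_Icc, not_and_or] at hc
      rcases hc with hc | hc
      · rw [apply_eq_zero_of_not_le hc, zero_mul]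
      · rw [apply_eq_zero_of_not_le hc, mul_zero])

theorem definingRep_apply (g : IncidenceAlgebra K P) (v : P → K) (a : P) :
    definingRep K P g v a = ∑ b, g a b * v b := rfl

end

end IncidenceAlgebra

/-! Pointedness gives primitive orthogonal idempotents `e i` dual to the characters `χ i` of `A`,
and acyclicity gives `e i * A * e i = K * e i`: an element of that corner inside the radical must
lie in every power of the radical, or else it would trace a closed path in the Ext quiver. All three
conditions on `M` are compared with thinness, that each `e i • M` has dimension at most one.
Thinness makes a submodule the sum of a subset of these lines, hence distributivity and finiteness.
Conversely, distributivity, or finiteness over an infinite field, applied to cyclic submodules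
generated inside `e i • M` forces thinness. Orbits of units correspond to cyclic submodules. For
thin `M`, choose a vector on each nonzero line. Cutting `b` by idempotents gives a multiple of a
matrix unit, so `B` is spanned by the matrix units in its support. That support is a partial order:
a product of nonzero maps between lines is nonzero, and `e i * A * e j * A * e i = 0` for `i ≠ j`.
For (2), the diagonal idempotents of any presentation `ψ` also have scalar corners, so `M` is thin
for them too. The same criterion yields `ψ'` over the same poset, and `φ` compares `ψ` with `ψ'`. -/

/-! ### Characters and idempotents of a pointed algebra. -/

section Pointed

variable {K : Type w} [Field K] {A : Type u} [Ring A] [Algebra K A]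

/-- The maximal left ideals of a pointed algebra are the kernels of its characters. -/
theorem IsPointedAlgebra.exists_algHom_ker_eq (h : IsPointedAlgebra K A) (I : Ideal A)
    [hI : I.IsMaximal] : ∃ χ : A →ₐ[K] K, ∀ a, χ a = 0 ↔ a ∈ I := by
  have : IsSimpleModule A (A ⧸ I) := isSimpleModule_iff_isCoatom.2 hI.out
  have h1 : (1 : A) ∉ I := fun h1 => hI.ne_top ((Ideal.eq_top_iff_one I).2 h1)
  have hdim : Module.finrank K (A ⧸ I) = 1 := h (A ⧸ I)
  have hne : (Submodule.Quotient.mk 1 : A ⧸ I) ≠ 0 := by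
    rwa [Ne, Submodule.Quotient.mk_eq_zero]
  have hex : ∀ a : A, ∃ k : K, a - algebraMap K A k ∈ I := by
    intro a
    obtain ⟨k, hk⟩ := (finrank_eq_one_iff_of_nonzero' _ hne).1 hdim (Submodule.Quotient.mk a)
    refine ⟨k, (Submodule.Quotient.eq I).1 ?_⟩
    rw [← hk, Algebra.algebraMap_eq_smul_one]
    rfl
  have huniq : ∀ k : K, algebraMap K A k ∈ I → k = 0 := by
    intro k hk
    by_contra hk0
    refine h1 ?_
    have := I.mul_mem_left (algebraMap K A k⁻¹) hk
    rwa [← map_mul, inv_mul_cancel₀ hk0, map_one] at this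
  choose χ hχ using hex
  have key : ∀ a k, a - algebraMap K A k ∈ I → χ a = k := by
    intro a k hk
    refine sub_eq_zero.1 (huniq _ ?_)
    have := I.sub_mem hk (hχ a)
    rwa [sub_sub_sub_cancel_left, ← map_sub] at this
  refine ⟨{ toFun := χ, map_one' := ?_, map_mul' := ?_, map_zero' := ?_, map_add' := ?_,
            commutes' := ?_ }, fun a => ⟨fun h0 => ?_, fun ha => ?_⟩⟩
  · exact key _ _ (by simp)
  · intro a b
    refine key _ _ ?_
    -- `I` is only a left ideal, so its elements must stand on the right; this is possible because
    -- scalars are central.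
    have : a * b - algebraMap K A (χ a * χ b) =
        a * (b - algebraMap K A (χ b)) + algebraMap K A (χ b) * (a - algebraMap K A (χ a)) := by
      rw [map_mul, mul_sub, mul_sub, Algebra.commutes (χ b) a, ← map_mul, ← map_mul, mul_comm (χ b)]
      abel
    rw [this]
    exact I.add_mem (I.mul_mem_left _ (hχ b)) (I.mul_mem_left _ (hχ a))
  · exact key _ _ (by simp)
  · intro a b
    refine key _ _ ?_
    rw [map_add, add_sub_add_comm]
    exact I.add_mem (hχ a) (hχ b)
  · intro k
    exact key _ _ (by simp)
  · have h0 : χ a = 0 := h0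
    simpa [h0] using hχ a
  · exact key a 0 (by simpa using ha)

/-- A complete set of orthogonal idempotents `e i` of a finite-dimensional algebra, dual to a
set of characters `χ i` whose kernels are all the maximal left ideals. -/
structure SplitIdempotents {ι : Type*} [Fintype ι] [DecidableEq ι] (χ : ι → A →ₐ[K] K) (e : ι → A) :
    Prop where
  complete : CompleteOrthogonalIdempotents e
  apply_idem : ∀ i j, χ i (e j) = if i = j then 1 else 0
  mem_jacobson : ∀ a, a ∈ Ring.jacobson A ↔ ∀ i, χ i a = 0
  isUnit : ∀ a, (∀ i, χ i a ≠ 0) → IsUnit a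

/-- Dedekind's independence of characters. It bounds the number of characters and makes the joint
map to a power of `K` surjective. -/
theorem AlgHom.linearIndependent_toLinearMap :
    LinearIndependent K (fun χ : A →ₐ[K] K => (χ.toLinearMap : A →ₗ[K] K)) := by
  have h := linearIndependent_monoidHom A K
  have h2 : LinearIndependent K (fun χ : A →ₐ[K] K => (χ : A → K)) :=
    h.comp (fun χ : A →ₐ[K] K => (χ : A →* K)) fun χ χ' hχ => by
      ext a; exact DFunLike.congr_fun hχ a
  exact LinearIndependent.of_comp
    ({ toFun := fun f => f, map_add' := fun _ _ => rfl, map_smul' := fun _ _ => rfl } :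
      (A →ₗ[K] K) →ₗ[K] (A → K)) h2

/-- The characters together map `A` onto `K^n` with kernel the radical, which is nilpotent; the
standard idempotents of `K^n` therefore lift. -/
theorem IsPointedAlgebra.exists_splitIdempotents [Module.Finite K A] (h : IsPointedAlgebra K A) :
    ∃ (n : ℕ) (χ : Fin n → A →ₐ[K] K) (e : Fin n → A), SplitIdempotents χ e := by
  have hli := AlgHom.linearIndependent_toLinearMap (K := K) (A := A)
  have : Finite (A →ₐ[K] K) := hli.finite
  obtain ⟨n, ⟨E⟩⟩ := Finite.exists_equiv_fin (A →ₐ[K] K)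
  let χ : Fin n → A →ₐ[K] K := fun i => E.symm i
  have hJ : ∀ a, a ∈ Ring.jacobson A ↔ ∀ i, χ i a = 0 := by
    intro a
    rw [Ring.jacobson_eq_sInf_isMaximal, Submodule.mem_sInf]
    constructor
    · intro ha i
      have hs : Function.Surjective (χ i) := fun k => ⟨algebraMap K A k, by simp⟩
      exact ha (RingHom.ker (χ i)) (RingHom.ker_isMaximal_of_surjective (χ i) hs)
    · intro ha I hI
      have : Ideal.IsMaximal I := hI
      obtain ⟨φ, hφ⟩ := h.exists_algHom_ker_eq I
      rw [← hφ]
      simpa [χ] using ha (E φ)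
  have hart : IsArtinianRing A := IsArtinianRing.of_finite K A
  have hunit : ∀ a, (∀ i, χ i a ≠ 0) → IsUnit a := by
    intro a ha
    have htop : Ideal.span {a} = ⊤ := by
      by_contra hne
      obtain ⟨I, hI, hle⟩ := Ideal.exists_le_maximal _ hne
      obtain ⟨φ, hφ⟩ := h.exists_algHom_ker_eq I
      have h0 : φ a = 0 := (hφ a).2 (hle (Ideal.subset_span rfl))
      exact ha (E φ) (by simpa [χ] using h0)
    have h1 : (1 : A) ∈ Ideal.span {a} := htop ▸ Submodule.mem_top
    obtain ⟨b, hb⟩ := Ideal.mem_span_singleton'.1 h1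
    exact IsUnit.of_mul_eq_one_right b hb
  let F : A →ₐ[K] (Fin n → K) := AlgHom.pi χ
  have hF : Function.Surjective F := by
    rw [← AlgHom.coe_toLinearMap, ← LinearMap.range_eq_top]
    -- A functional killing a proper image would be a linear relation between the characters.
    by_contra hne
    obtain ⟨f, hf0, hf⟩ := Submodule.exists_le_ker_of_lt_top _ (lt_top_iff_ne_top.2 hne)
    have hli' : LinearIndependent K (fun i => (χ i).toLinearMap) := hli.comp _ E.symm.injective
    rw [Fintype.linearIndependent_iff] at hli'
    refine hf0 ?_
    have hz := hli' (fun i => f (Pi.single i 1)) ?_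
    · refine LinearMap.pi_ext' fun i => LinearMap.ext_ring ?_
      simpa using hz i
    · ext a
      have : f (F a) = 0 := hf ⟨a, rfl⟩
      rw [LinearMap.pi_apply_eq_sum_univ f] at this
      have hs : ∀ i : Fin n, (fun j => if i = j then (1 : K) else 0) = Pi.single i 1 := fun i => by
        ext j; simp [Pi.single_apply, eq_comm]
      simpa [F, mul_comm, hs] using this
  have hker : ∀ x ∈ RingHom.ker F.toRingHom, IsNilpotent x := by
    intro a ha
    have ha' : a ∈ Ring.jacobson A := (hJ a).2 fun i => congr_fun (RingHom.mem_ker.1 ha) i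
    obtain ⟨N, hN⟩ := IsSemiprimaryRing.isNilpotent (R := A)
    exact ⟨N, by simpa [hN] using Ideal.pow_mem_pow ha' N⟩
  obtain ⟨e, he, hFe⟩ := CompleteOrthogonalIdempotents.lift_of_isNilpotent_ker F.toRingHom hker
    (CompleteOrthogonalIdempotents.single (fun _ : Fin n => K)) (fun i => hF _)
  refine ⟨n, χ, e, he, fun i j => ?_, hJ, hunit⟩
  have := congr_fun (congr_fun hFe j) i
  simpa [F, Pi.single_apply] using this

end Pointed

/-! ### Extensions, arrows of the Ext quiver, and acyclicity. -/

open CategoryTheory in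
/-- A short exact sequence without a section gives a nonzero extension group. -/
theorem CategoryTheory.ShortComplex.ShortExact.nontrivial_ext {C : Type*} [Category C] [Abelian C]
    [HasExt.{w} C] {S : ShortComplex C} (hS : S.ShortExact) (h : ∀ s : S.X₃ ⟶ S.X₂, s ≫ S.g ≠ 𝟙 _) :
    Nontrivial (Abelian.Ext.{w} S.X₃ S.X₁ 1) := by
  by_contra hn
  rw [not_nontrivial_iff_subsingleton] at hn
  -- The obstruction to lifting the identity of `S.X₃` to `S.X₂` lies in the vanishing group.
  obtain ⟨s, hs⟩ := Abelian.Ext.covariant_sequence_exact₃ S.X₃ hS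
    (Abelian.Ext.mk₀ (𝟙 S.X₃)) (zero_add 1) (Subsingleton.elim _ _)
  obtain ⟨s, rfl⟩ := Abelian.Ext.homEquiv₀.symm.surjective s
  refine h s ((Abelian.Ext.mk₀_bijective _ _).1 ?_)
  simpa using hs

section Arrows

variable {K : Type w} [Field K] {A : Type u} [Ring A] [Algebra K A]

/-- A derivation between two characters that does not vanish on a common zero of the characters
gives an arrow of the Ext quiver. -/
theorem extArrow_of_derivation (χ η : A →ₐ[K] K) (δ : A →ₗ[K] K)
    (hδ : ∀ a b, δ (a * b) = η a * δ b + δ a * χ b) {z : A} (hχ : χ z = 0) (hη : η z = 0)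
    (hz : δ z ≠ 0) :
    ExtArrow (ModuleCat.of A (A ⧸ (RingHom.ker χ : Ideal A)))
      (ModuleCat.of A (A ⧸ (RingHom.ker η : Ideal A))) := by
  have hsimple : ∀ θ : A →ₐ[K] K, IsSimpleModule A (A ⧸ (RingHom.ker θ : Ideal A)) := fun θ =>
    isSimpleModule_iff_isCoatom.2
      (RingHom.ker_isMaximal_of_surjective θ fun k => ⟨algebraMap K A k, by simp⟩).out
  refine ⟨hsimple χ, hsimple η, ?_⟩
  -- The matrices with rows `(η a, δ a)` and `(0, χ a)` form a representation; `I` is the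
  -- annihilator of the second basis vector, and `A ⧸ I` is the extension sought.
  let I : Ideal A :=
    { carrier := {a | δ a = 0 ∧ χ a = 0}
      add_mem' := fun {a b} ha hb => by
        simp only [Set.mem_ofPred_eq] at ha hb ⊢; simp [ha, hb]
      zero_mem' := by simp
      smul_mem' := fun c a ha => by
        simp only [Set.mem_ofPred_eq, smul_eq_mul] at ha ⊢; simp [hδ, ha] }
  have hI : ∀ a, a ∈ I ↔ δ a = 0 ∧ χ a = 0 := fun a => Iff.rfl
  let f : (A ⧸ (RingHom.ker η : Ideal A)) →ₗ[A] A ⧸ I :=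
    Submodule.mapQ _ I (LinearMap.toSpanSingleton A A z) fun a ha => by
      have : η a = 0 := ha
      rw [Submodule.mem_comap, LinearMap.toSpanSingleton_apply, smul_eq_mul, hI]
      simp [hδ, this, hχ]
  let g : (A ⧸ I) →ₗ[A] A ⧸ (RingHom.ker χ : Ideal A) :=
    Submodule.mapQ I _ LinearMap.id fun a ha => ha.2
  have hfg : g ∘ₗ f = 0 := by
    refine LinearMap.ext fun y => ?_
    obtain ⟨b, rfl⟩ := Submodule.Quotient.mk_surjective _ y
    refine (Submodule.Quotient.mk_eq_zero (RingHom.ker χ : Ideal A)).2 ?_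
    simp [hχ]
  let S : CategoryTheory.ShortComplex (ModuleCat.{u} A) :=
    CategoryTheory.ShortComplex.mk (ModuleCat.ofHom f) (ModuleCat.ofHom g) (by
      rw [← ModuleCat.ofHom_comp, hfg]; rfl)
  have hS : S.ShortExact := by
    refine CategoryTheory.ShortComplex.ShortExact.mk' ?_ ?_ ?_
    · rw [CategoryTheory.ShortComplex.moduleCat_exact_iff]
      intro b hb
      obtain ⟨b, rfl⟩ := Submodule.Quotient.mk_surjective _ (show A ⧸ I from b)
      have hb : χ b = 0 := (Submodule.Quotient.mk_eq_zero (RingHom.ker χ : Ideal A)).1 hb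
      refine ⟨Submodule.Quotient.mk (algebraMap K A (δ b / δ z)), ?_⟩
      refine (Submodule.Quotient.eq I).2 ?_
      rw [LinearMap.toSpanSingleton_apply, smul_eq_mul, hI, ← Algebra.smul_def]
      simp [hχ, hb, hz]
    · rw [ModuleCat.mono_iff_injective, injective_iff_map_eq_zero]
      intro a ha
      obtain ⟨a, rfl⟩ := Submodule.Quotient.mk_surjective _
        (show A ⧸ (RingHom.ker η : Ideal A) from a)
      have ha : a * z ∈ I := (Submodule.Quotient.mk_eq_zero I).1 ha
      refine (Submodule.Quotient.mk_eq_zero (RingHom.ker η : Ideal A)).2 ?_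
      rw [hI, hδ, hχ, mul_zero, add_zero] at ha
      exact (mul_eq_zero.1 ha.1).resolve_right hz
    · rw [ModuleCat.epi_iff_surjective]
      intro b
      obtain ⟨b, rfl⟩ := Submodule.Quotient.mk_surjective _
        (show A ⧸ (RingHom.ker χ : Ideal A) from b)
      exact ⟨Submodule.Quotient.mk b, rfl⟩
  refine hS.nontrivial_ext fun s hs => ?_
  let t : (A ⧸ (RingHom.ker χ : Ideal A)) →ₗ[A] A ⧸ I := s.hom
  have ht : ∀ y, g (t y) = y := fun y => congrArg (fun q => q.hom y) hs
  obtain ⟨b, hb⟩ := Submodule.Quotient.mk_surjective _ (t (Submodule.Quotient.mk 1))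
  have h1 : χ b = 1 := by
    have := ht (Submodule.Quotient.mk 1)
    rw [← hb] at this
    have h2 : b - 1 ∈ (RingHom.ker χ : Ideal A) := (Submodule.Quotient.eq _).1 this
    rw [RingHom.mem_ker, map_sub, map_one, sub_eq_zero] at h2
    exact h2
  -- A section sends the class of `z`, which is zero, to the class of `z * b`; but `δ (z * b) = δ
  -- z`.
  have h2 : z * b ∈ I := by
    rw [← Submodule.Quotient.mk_eq_zero I, ← smul_eq_mul, Submodule.Quotient.mk_smul, hb,
      ← map_smul, ← Submodule.Quotient.mk_smul, smul_eq_mul, mul_one,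
      (Submodule.Quotient.mk_eq_zero (RingHom.ker χ : Ideal A)).2 hχ, map_zero]
  rw [hI, hδ, hη, h1, zero_mul, zero_add, mul_one] at h2
  exact hz h2.1

variable {ι : Type*} [Fintype ι] [DecidableEq ι] {χ : ι → A →ₐ[K] K} {e : ι → A}

namespace SplitIdempotents

/-- Project `A` to its radical `J` along the span of the idempotents, cut by `e j` and `e i`, and
apply a functional that kills `J ^ 2`. The result is a derivation, because the projection fails the
Leibniz rule only by a term in `J ^ 2`. -/
theorem extArrow (h : SplitIdempotents χ e) {i j : ι} {a : A} (ha : a ∈ Ring.jacobson A)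
    (haij : e j * a * e i ∉ Ring.jacobson A ^ 2) :
    ExtArrow (ModuleCat.of A (A ⧸ (RingHom.ker (χ i) : Ideal A)))
      (ModuleCat.of A (A ⧸ (RingHom.ker (χ j) : Ideal A))) := by
  set J := Ring.jacobson A with hJ
  obtain ⟨f, hfz, hf⟩ := Submodule.exists_le_ker_of_notMem
    (p := (J ^ 2).restrictScalars K) haij
  let D : A →ₗ[K] A := ∑ k, (χ k).toLinearMap.smulRight (e k)
  have hD : ∀ a, D a = ∑ k, χ k a • e k := fun a => by simp [D]
  have hmem : ∀ a, a - D a ∈ J := fun a => by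
    rw [h.mem_jacobson]
    intro k
    simp [hD, h.apply_idem]
  have heD : ∀ k a, e k * D a = χ k a • e k := fun k a => by
    simp [hD, Finset.mul_sum, h.complete.mul_eq]
  have hDe : ∀ k a, D a * e k = χ k a • e k := fun k a => by
    simp [hD, Finset.sum_mul, h.complete.mul_eq]
  have hDD : ∀ a b, D (a * b) = D a * D b := fun a b => by
    rw [hD a, Finset.sum_mul, hD]
    simp [heD, mul_smul]
  let δ : A →ₗ[K] K := f ∘ₗ LinearMap.mulLeftRight K (e j, e i) ∘ₗ (LinearMap.id - D)
  have hδ' : ∀ a, δ a = f (e j * (a - D a) * e i) := fun a => by simp [δ]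
  refine extArrow_of_derivation (χ i) (χ j) δ (fun a b => ?_) (z := a)
    ((h.mem_jacobson a).1 ha i) ((h.mem_jacobson a).1 ha j) ?_
  · have hab : e j * ((a - D a) * (b - D b)) * e i ∈ J ^ 2 := by
      refine Ideal.mul_mem_right _ _ (Ideal.mul_mem_left _ _ ?_)
      rw [Ideal.IsTwoSided.pow_succ, Submodule.pow_one]
      exact Ideal.mul_mem_mul (hmem a) (hmem b)
    have hz : f (e j * ((a - D a) * (b - D b)) * e i) = 0 := hf hab
    have hsplit : e j * (a * b - D (a * b)) * e i =
        χ j a • (e j * (b - D b) * e i) + χ i b • (e j * (a - D a) * e i) +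
          e j * ((a - D a) * (b - D b)) * e i := by
      have h1 : χ j a • (e j * (b - D b) * e i) = e j * D a * (b - D b) * e i := by
        rw [heD]; simp
      have h2 : χ i b • (e j * (a - D a) * e i) = e j * (a - D a) * (D b * e i) := by
        rw [hDe]; simp
      rw [h1, h2, hDD]
      noncomm_ring
    rw [hδ', hsplit, map_add, map_add, hz, map_smul, map_smul, ← hδ', ← hδ']
    simp [mul_comm]
  · have : D a = 0 := by
      rw [hD]
      exact Finset.sum_eq_zero fun k _ => by rw [(h.mem_jacobson a).1 ha k, zero_smul]
    rw [hδ', this, sub_zero]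
    exact hfz

/-- Insert `∑ l, e l = 1` between the factors of a product: if no summand splits as an arrow after a
path, each lies one radical power deeper. -/
theorem transGen_extArrow (h : SplitIdempotents χ e) (k : ℕ) : ∀ {i j : ι} {a : A},
    a ∈ Ring.jacobson A ^ (k + 1) → e j * a * e i ∉ Ring.jacobson A ^ (k + 2) →
    Relation.TransGen ExtArrow (ModuleCat.of A (A ⧸ (RingHom.ker (χ i) : Ideal A)))
      (ModuleCat.of A (A ⧸ (RingHom.ker (χ j) : Ideal A))) := by
  induction k with
  | zero =>
    intro i j a ha haij
    exact .single (h.extArrow (by rwa [zero_add, Submodule.pow_one] at ha) haij)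
  | succ k ih =>
    intro i j a ha haij
    rw [Ideal.IsTwoSided.pow_succ] at ha
    -- The contrapositive is an ideal membership, which is additive in `a`, so it suffices to treat
    -- products.
    contrapose! haij
    induction ha using Submodule.mul_induction_on' with
    | mem_mul_mem y hy z hz =>
      have hsum : e j * (y * z) * e i = ∑ l, e j * y * e l * (e l * z * e i) := by
        calc e j * (y * z) * e i = e j * y * (∑ l, e l) * z * e i := by
              rw [h.complete.complete]; noncomm_ring
          _ = _ := by
              simp only [Finset.mul_sum, Finset.sum_mul]
              refine Finset.sum_congr rfl fun l _ => ?_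
              conv_lhs => rw [← (h.complete.idem l).eq]
              noncomm_ring
      rw [hsum]
      refine Ideal.sum_mem _ fun l _ => ?_
      by_cases h1 : e j * y * e l ∈ Ring.jacobson A ^ 2
      · have h2 : e l * z * e i ∈ Ring.jacobson A ^ (k + 1) :=
          Ideal.mul_mem_right _ _ (Ideal.mul_mem_left _ _ hz)
        rw [show k + 1 + 2 = 2 + (k + 1) by ring, Ideal.IsTwoSided.pow_add]
        exact Ideal.mul_mem_mul h1 h2
      · have h2 : e l * z * e i ∈ Ring.jacobson A ^ (k + 2) := by
          by_contra h2
          exact haij ((ih hz h2).tail (h.extArrow hy h1))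
        rw [show k + 1 + 2 = (k + 2) + 1 by ring, Ideal.IsTwoSided.pow_succ]
        exact Ideal.mul_mem_mul (Ideal.mul_mem_right _ _ (Ideal.mul_mem_left _ _ hy)) h2
    | add y _ z _ hy hz =>
      rw [mul_add, add_mul]
      exact Ideal.add_mem _ hy hz

variable [Module.Finite K A]

/-- In an acyclic algebra the corners of the Jacobson radical vanish. -/
theorem corner_jacobson (h : SplitIdempotents χ e) (hac : IsAcyclicAlgebra A) (i : ι) {a : A}
    (ha : a ∈ Ring.jacobson A) : e i * a * e i = 0 := by
  -- Leaving the radical filtration at any stage would give an oriented cycle through `i`.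
  have hpow : ∀ k, e i * a * e i ∈ Ring.jacobson A ^ (k + 1) := by
    intro k
    induction k with
    | zero =>
      rw [zero_add, Submodule.pow_one]
      exact Ideal.mul_mem_right _ _ (Ideal.mul_mem_left _ _ ha)
    | succ k ih =>
      by_contra hk
      refine hac _ (h.transGen_extArrow k (i := i) (j := i) ih ?_)
      rwa [show e i * (e i * a * e i) * e i = (e i * e i) * a * (e i * e i) by noncomm_ring,
        (h.complete.idem i).eq]
  have hart : IsArtinianRing A := IsArtinianRing.of_finite K A
  obtain ⟨N, hN⟩ := IsSemiprimaryRing.isNilpotent (R := A)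
  have := Ideal.pow_le_pow_right (Nat.le_succ N) (hpow N)
  simpa [hN] using this

/-- Modulo the radical, `a` is a combination of the idempotents, and the radical has no corner at
`i`. -/
theorem corner (h : SplitIdempotents χ e) (hac : IsAcyclicAlgebra A) (i : ι) (a : A) :
    e i * a * e i = χ i a • e i := by
  have hmem : a - ∑ k, χ k a • e k ∈ Ring.jacobson A := by
    rw [h.mem_jacobson]
    intro k
    simp [h.apply_idem]
  have := h.corner_jacobson hac i hmem
  rw [mul_sub, sub_mul, sub_eq_zero] at this
  rw [this]
  simp [Finset.mul_sum, h.complete.mul_eq]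

theorem corner_mul_corner (h : SplitIdempotents χ e) (hac : IsAcyclicAlgebra A) {i j : ι}
    (hij : i ≠ j) (a b : A) : e i * a * e j * b * e i = 0 := by
  rw [show e i * a * e j * b * e i = e i * (a * e j * b) * e i by noncomm_ring, h.corner hac]
  simp [h.apply_idem, hij]

end SplitIdempotents

end Arrows

/-! ### Thinness, distributivity, finiteness and orbits. -/

section Modules

variable {K : Type w} [Field K] {A : Type u} [Ring A] [Algebra K A]
  {M : Type v} [AddCommGroup M] [Module K M] [Module A M] [IsScalarTower K A M]

/-- The element `e` acts on `M` with image of dimension at most one. -/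
def IsThinOn (K : Type w) {A : Type u} (M : Type v) [Field K] [Ring A] [AddCommGroup M] [Module K M]
    [Module A M] (e : A) : Prop :=
  ∀ v w : M, e • v = v → e • w = w → v ≠ 0 → ∃ k : K, w = k • v

omit [Algebra K A] [IsScalarTower K A M] in
theorem smul_eq_smul_of_corner {e a : A} {k : K} (h : ∀ n : M, e • a • e • n = k • e • n) {n : M}
    (hn : e • n = n) : e • a • n = k • n := by
  simpa only [hn] using h n

omit [Algebra K A] [IsScalarTower K A M] in
-- Distributivity for the cyclic submodules of `v + w`, `v`, `w` splits `v + w` into multiples of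
-- itself that are also multiples of `v` and of `w`. Applying `e` turns all coefficients into
-- scalars.
theorem IsDistributiveModule.isThinOn (h : IsDistributiveModule A M) {e : A}
    (he : ∀ a : A, ∃ k : K, ∀ n : M, e • a • e • n = k • e • n) : IsThinOn K M e := by
  intro v w hv hw hv0
  have hvw : e • (v + w) = v + w := by rw [smul_add, hv, hw]
  have hmem : v + w ∈ Submodule.span A {v + w} ⊓ (Submodule.span A {v} ⊔ Submodule.span A {w}) :=
    ⟨Submodule.mem_span_singleton_self _,
      Submodule.add_mem_sup (Submodule.mem_span_singleton_self _)
        (Submodule.mem_span_singleton_self _)⟩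
  rw [h] at hmem
  obtain ⟨y, ⟨hy1, hy2⟩, z, ⟨hz1, hz2⟩, hyz⟩ := Submodule.mem_sup.1 hmem
  obtain ⟨a, rfl⟩ := Submodule.mem_span_singleton.1 hy1
  obtain ⟨c, rfl⟩ := Submodule.mem_span_singleton.1 hz1
  obtain ⟨b, hb⟩ := Submodule.mem_span_singleton.1 hy2
  obtain ⟨d, hd⟩ := Submodule.mem_span_singleton.1 hz2
  obtain ⟨α, hα⟩ := he a
  obtain ⟨β, hβ⟩ := he b
  obtain ⟨γ, hγ⟩ := he c
  obtain ⟨δ, hδ⟩ := he d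
  have h1 : β • v = α • (v + w) := by
    rw [← smul_eq_smul_of_corner hα hvw, ← hb, smul_eq_smul_of_corner hβ hv]
  have h2 : δ • w = γ • (v + w) := by
    rw [← smul_eq_smul_of_corner hγ hvw, ← hd, smul_eq_smul_of_corner hδ hw]
  have h3 : α • (v + w) + γ • (v + w) = v + w := by
    rw [← smul_eq_smul_of_corner hα hvw, ← smul_eq_smul_of_corner hγ hvw, ← smul_add, hyz, hvw]
  by_cases hα0 : α = 0
  · rw [hα0, zero_smul, zero_add, ← h2] at h3
    have h4 : v = (δ - 1) • w := by rw [sub_smul, h3, one_smul]; abel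
    have hδ1 : δ - 1 ≠ 0 := fun h0 => hv0 (by rw [h4, h0, zero_smul])
    exact ⟨(δ - 1)⁻¹, by rw [h4, smul_smul, inv_mul_cancel₀ hδ1, one_smul]⟩
  · refine ⟨α⁻¹ * β - 1, ?_⟩
    rw [sub_smul, mul_smul, h1, smul_smul, inv_mul_cancel₀ hα0, one_smul, one_smul]
    abel

/-- Two of the infinitely many `v + t • w` generate the same submodule; after applying `e` they are
proportional, which forces a linear relation between `v` and `w`. -/
theorem isThinOn_of_finite_submodule [Infinite K] [Finite (Submodule A M)] {e : A}
    (he : ∀ a : A, ∃ k : K, ∀ n : M, e • a • e • n = k • e • n) : IsThinOn K M e := by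
  intro v w hv hw hv0
  obtain ⟨s, t, hst, heq⟩ :=
    Finite.exists_ne_map_eq_of_infinite (fun t : K => Submodule.span A {v + t • w})
  have hcomm : ∀ t : K, e • (v + t • w) = v + t • w := fun t => by
    rw [smul_add, hv, ← algebraMap_smul A t w, smul_smul, ← Algebra.commutes, mul_smul, hw]
  have hmem : v + t • w ∈ Submodule.span A {v + s • w} := by
    change Submodule.span A {v + s • w} = Submodule.span A {v + t • w} at heq
    exact heq ▸ Submodule.mem_span_singleton_self _
  obtain ⟨a, ha⟩ := Submodule.mem_span_singleton.1 hmem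
  obtain ⟨α, hα⟩ := he a
  have h1 : v + t • w = α • (v + s • w) := by
    rw [← smul_eq_smul_of_corner hα (hcomm s), ha, hcomm]
  have h2 : (t - α * s) • w = (α - 1) • v := by
    rw [sub_smul, sub_smul, mul_smul, one_smul, sub_eq_sub_iff_add_eq_add, add_comm, h1, smul_add]
  by_cases h0 : t - α * s = 0
  · rw [h0, zero_smul, eq_comm, smul_eq_zero, or_iff_left hv0, sub_eq_zero] at h2
    rw [h2, one_mul, sub_eq_zero] at h0
    exact absurd h0.symm hst
  · exact ⟨(t - α * s)⁻¹ * (α - 1), by rw [mul_smul, ← h2, smul_smul, inv_mul_cancel₀ h0, one_smul]⟩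

variable {ι : Type*} [Fintype ι] {e : ι → A}

theorem CompleteOrthogonalIdempotents.sum_smul (he : CompleteOrthogonalIdempotents e) (n : M) :
    ∑ i, e i • n = n := by
  rw [← Finset.sum_smul, he.complete, one_smul]

theorem CompleteOrthogonalIdempotents.smul_smul_self (he : CompleteOrthogonalIdempotents e) (i : ι)
    (n : M) : e i • e i • n = e i • n := by
  rw [smul_smul, (he.idem i).eq]

theorem isDistributiveModule_of_isThinOn (he : CompleteOrthogonalIdempotents e)
    (ht : ∀ i, IsThinOn K M (e i)) : IsDistributiveModule A M := by
  intro X Y Z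
  refine le_antisymm (fun n hn => ?_) le_inf_sup
  obtain ⟨y, hy, z, hz, rfl⟩ := Submodule.mem_sup.1 hn.2
  rw [← he.sum_smul (y + z)]
  refine Submodule.sum_mem _ fun i _ => ?_
  have hX : e i • (y + z) ∈ X := X.smul_mem _ hn.1
  by_cases h0 : e i • y = 0
  · refine Submodule.mem_sup_right ⟨hX, ?_⟩
    rw [smul_add, h0, zero_add]
    exact Z.smul_mem _ hz
  · refine Submodule.mem_sup_left ⟨hX, ?_⟩
    obtain ⟨k, hk⟩ := ht i _ (e i • (y + z)) (he.smul_smul_self i y) (he.smul_smul_self i _) h0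
    rw [hk]
    exact Y.smul_of_tower_mem k (Y.smul_mem _ hy)

/-- A submodule is determined by the set of `i` for which it meets the line `e i • M`. -/
theorem finite_submodule_of_isThinOn (he : CompleteOrthogonalIdempotents e)
    (ht : ∀ i, IsThinOn K M (e i)) : Finite (Submodule A M) := by
  have key : ∀ N N' : Submodule A M, {i | ∃ v ∈ N, e i • v ≠ 0} ⊆ {i | ∃ v ∈ N', e i • v ≠ 0} →
      N ≤ N' := by
    intro N N' h n hn
    rw [← he.sum_smul n]
    refine Submodule.sum_mem _ fun i _ => ?_
    by_cases h0 : e i • n = 0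
    · rw [h0]; exact N'.zero_mem
    · obtain ⟨v, hv, hv0⟩ := h ⟨n, hn, h0⟩
      obtain ⟨k, hk⟩ := ht i _ (e i • n) (he.smul_smul_self i v) (he.smul_smul_self i _) hv0
      rw [hk]
      exact N'.smul_of_tower_mem k (N'.smul_mem _ hv)
  exact Finite.of_injective (fun N : Submodule A M => {i | ∃ v ∈ N, e i • v ≠ 0})
    fun N N' h => le_antisymm (key _ _ (le_of_eq h)) (key _ _ (ge_of_eq h))

omit [Module K M] [IsScalarTower K A M] in
theorem SplitIdempotents.exists_unit_smul_eq [DecidableEq ι] {χ : ι → A →ₐ[K] K}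
    (h : SplitIdempotents χ e) {n n' : M} (hn : Submodule.span A {n} = Submodule.span A {n'}) :
    ∃ u : Aˣ, u • n = n' := by
  obtain ⟨a, ha⟩ := Submodule.mem_span_singleton.1 (hn ▸ Submodule.mem_span_singleton_self n')
  obtain ⟨b, hb⟩ := Submodule.mem_span_singleton.1 (hn ▸ Submodule.mem_span_singleton_self n)
  classical
  -- Since `1 - b * a` kills `n`, adding `c * (1 - b * a)` to `a` does not change its value at `n`;
  -- `c` is chosen so that every character vanishing on `a` takes the value `1` on the sum.
  let c : A := ∑ i, if χ i a = 0 then e i else 0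
  have hc : ∀ j, χ j c = if χ j a = 0 then 1 else 0 := by
    intro j
    have : ∀ i, χ j (if χ i a = 0 then e i else 0) = if j = i then if χ i a = 0 then 1 else 0 else 0 := by
      intro i
      rw [apply_ite (χ j), map_zero, h.apply_idem]
      split_ifs <;> rfl
    simp only [c, map_sum, this]
    simp
  have hu : IsUnit (a + c * (1 - b * a)) := by
    refine h.isUnit _ fun j => ?_
    by_cases h0 : χ j a = 0 <;> simp [hc, h0]
  obtain ⟨u, hu⟩ := hu
  refine ⟨u, ?_⟩
  rw [Units.smul_def, hu, add_smul, mul_smul, sub_smul, mul_smul, one_smul, ha, hb, sub_self,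
    smul_zero, add_zero]

omit [Module K M] [IsScalarTower K A M] in
theorem SplitIdempotents.finite_orbits [DecidableEq ι] {χ : ι → A →ₐ[K] K}
    (h : SplitIdempotents χ e) [Finite (Submodule A M)] :
    Finite (MulAction.orbitRel.Quotient Aˣ M) := by
  refine Finite.of_surjective
    (fun N : {N : Submodule A M // ∃ n, N = Submodule.span A {n}} =>
      (Quotient.mk'' N.2.choose : MulAction.orbitRel.Quotient Aˣ M)) fun q => ?_
  induction q using Quotient.inductionOn' with
  | h n =>
    refine ⟨⟨Submodule.span A {n}, n, rfl⟩, Quotient.sound' ?_⟩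
    generalize_proofs hex
    obtain ⟨u, hu⟩ := h.exists_unit_smul_eq hex.choose_spec
    exact ⟨u, hu⟩

/-- A submodule is a union of orbits. -/
theorem finite_submodule_of_finite_orbits [Finite (MulAction.orbitRel.Quotient Aˣ M)] :
    Finite (Submodule A M) := by
  have key : ∀ N N' : Submodule A M,
      (Quotient.mk'' '' (N : Set M) : Set (MulAction.orbitRel.Quotient Aˣ M)) ⊆
        Quotient.mk'' '' (N' : Set M) → N ≤ N' := by
    intro N N' h n hn
    obtain ⟨n', hn', heq⟩ := h ⟨n, hn, rfl⟩
    obtain ⟨u, hu⟩ := MulAction.orbitRel_apply.1 (Quotient.eq''.1 heq.symm)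
    rw [← hu]
    exact N'.smul_mem (u : A) hn'
  exact Finite.of_injective (fun N : Submodule A M =>
    (Quotient.mk'' '' (N : Set M) : Set (MulAction.orbitRel.Quotient Aˣ M)))
    fun N N' h => le_antisymm (key _ _ (le_of_eq h)) (key _ _ (ge_of_eq h))

end Modules

/-! ### Matrix units of the incidence algebra. -/

namespace IncidenceAlgebra

variable {K : Type w} [Field K] {P : Type x} [PartialOrder P] [DecidableEq P]

theorem elementary_apply {x y : P} (h : x ≤ y) (a b : P) :
    elementary K x y h a b = if a = x ∧ b = y then 1 else 0 := rfl

theorem elementary_ne_zero {x y : P} (h : x ≤ y) : elementary K x y h ≠ 0 := fun h0 => by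
  have := congrArg (fun g : IncidenceAlgebra K P => g x y) h0
  simp [elementary_apply] at this

variable [Fintype P] [LocallyFiniteOrder P]

theorem definingRep_single (g : IncidenceAlgebra K P) (a b : P) :
    definingRep K P g (Pi.single b 1) a = g a b := by
  rw [definingRep_apply]
  simp [Pi.single_apply]

/-- Faithfulness reduces the identities below to computations with column vectors. -/
theorem definingRep_injective : Function.Injective (definingRep K P) := fun g h hgh =>
  IncidenceAlgebra.ext fun a b _ => by rw [← definingRep_single, hgh, definingRep_single]

theorem definingRep_elementary {x y : P} (h : x ≤ y) (v : P → K) (a : P) :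
    definingRep K P (elementary K x y h) v a = if a = x then v y else 0 := by
  rw [definingRep_apply]
  by_cases hax : a = x <;> simp [elementary_apply, hax]

theorem elementary_mul_elementary {x y z : P} (hxy : x ≤ y) (hyz : y ≤ z) :
    elementary K x y hxy * elementary K y z hyz = elementary K x z (hxy.trans hyz) := by
  apply definingRep_injective
  ext v a
  simp [definingRep_elementary]

theorem elementary_mul_elementary_of_ne {x y z t : P} (hxy : x ≤ y) (hzt : z ≤ t) (hyz : y ≠ z) :
    elementary K x y hxy * elementary K z t hzt = 0 := by
  apply definingRep_injective
  ext v a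
  simp [definingRep_elementary, hyz]

theorem completeOrthogonalIdempotents_elementary :
    CompleteOrthogonalIdempotents (fun x : P => elementary K x x le_rfl) where
  idem x := elementary_mul_elementary le_rfl le_rfl
  ortho x y hxy := elementary_mul_elementary_of_ne le_rfl le_rfl hxy
  complete := by
    apply definingRep_injective
    refine LinearMap.ext fun v => funext fun a => ?_
    rw [map_sum, LinearMap.sum_apply, Finset.sum_apply]
    simp [definingRep_elementary]

theorem elementary_mul_mul_elementary (g : IncidenceAlgebra K P) (x : P) :
    elementary K x x le_rfl * g * elementary K x x le_rfl = g x x • elementary K x x le_rfl := by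
  apply definingRep_injective
  refine LinearMap.ext fun v => funext fun a => ?_
  simp only [map_mul, map_smul, Module.End.mul_apply, LinearMap.smul_apply, Pi.smul_apply,
    definingRep_elementary, definingRep_apply K P g]
  simp

theorem elementary_mul_mul_elementary_of_not_le (g : IncidenceAlgebra K P) {x y : P}
    (hxy : ¬ x ≤ y) : elementary K x x le_rfl * g * elementary K y y le_rfl = 0 := by
  apply definingRep_injective
  refine LinearMap.ext fun v => funext fun a => ?_
  simp only [map_mul, Module.End.mul_apply,
    definingRep_elementary, definingRep_apply K P g]
  simp [apply_eq_zero_of_not_le hxy]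

variable (K P) in
/-- The standard basis of the incidence algebra of a finite poset. -/
noncomputable def standardBasis :
    Module.Basis {p : P × P // p.1 ≤ p.2} K (IncidenceAlgebra K P) := by
  classical
  exact .ofEquivFun
    { toFun := fun g p => g p.1.1 p.1.2
      map_add' := fun _ _ => rfl
      map_smul' := fun _ _ => rfl
      invFun := fun c =>
        { toFun := fun a b => if h : a ≤ b then c ⟨(a, b), h⟩ else 0
          eq_zero_of_not_le' := fun a b h => dif_neg h }
      left_inv := fun g => by
        ext a b h
        exact dif_pos h
      right_inv := fun c => by
        ext p
        exact dif_pos p.2 }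

omit [LocallyFiniteOrder P] in
theorem standardBasis_apply {x y : P} (h : x ≤ y) :
    standardBasis K P ⟨(x, y), h⟩ = elementary K x y h := by
  refine (standardBasis K P).repr.injective (Finsupp.ext fun p => ?_)
  rw [Module.Basis.repr_self, Finsupp.single_apply]
  change _ = elementary K x y h p.1.1 p.1.2
  rw [elementary_apply]
  refine if_congr ?_ rfl rfl
  rw [Subtype.ext_iff, Prod.ext_iff, eq_comm, @eq_comm _ y]

end IncidenceAlgebra

/-! ### Recognising an incidence algebra from a faithful module. -/

section Criterion

variable {K : Type w} [Field K] {B : Type u} [Ring B] [Algebra K B]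
  {M : Type v} [AddCommGroup M] [Module K M] [Module B M] [IsScalarTower K B M]
  {Q : Type x} [PartialOrder Q] [Fintype Q] [DecidableEq Q] [LocallyFiniteOrder Q]

/-- An algebra acting faithfully on a module with a basis indexed by a finite poset, with the
matrix units of the incidence algebra among its matrices and with all matrices supported on the
order relation, is the incidence algebra. -/
theorem exists_algEquiv_incidenceAlgebra (hf : ∀ b : B, (∀ n : M, b • n = 0) → b = 0)
    (m : Module.Basis Q K M) (hle : ∀ (b : B) (x y : Q), m.repr (b • m y) x ≠ 0 → x ≤ y)
    (hunits : ∀ x y : Q, x ≤ y → ∃ b : B, b • m y = m x ∧ ∀ z, z ≠ y → b • m z = 0) :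
    ∃ ψ : B ≃ₐ[K] IncidenceAlgebra K Q, ∀ (b : B) (n : M),
      m.equivFun (b • n) = IncidenceAlgebra.definingRep K Q (ψ b) (m.equivFun n) := by
  classical
  let θ : B →ₐ[K] Module.End K (Q → K) :=
    (m.equivFun.conjAlgEquiv K).toAlgHom.comp (Algebra.lsmul K K M)
  have hθ : ∀ b n, θ b (m.equivFun n) = m.equivFun (b • n) := fun b n => by
    change m.equivFun (b • m.equivFun.symm (m.equivFun n)) = _
    rw [LinearEquiv.symm_apply_apply]
  have hinj : Function.Injective θ := by
    rw [injective_iff_map_eq_zero]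
    intro b hb
    refine hf b fun n => m.equivFun.injective ?_
    rw [← hθ, hb, map_zero, LinearMap.zero_apply]
  -- Both representations are faithful, so equality of their images identifies the algebras.
  have hrange : ∀ T, T ∈ θ.range ↔ T ∈ (IncidenceAlgebra.definingRep K Q).range := by
    intro T
    constructor
    · rintro ⟨b, rfl⟩
      refine ⟨⟨fun x y => m.repr (b • m y) x, fun x y h => by
        by_contra h0; exact h (hle b x y h0)⟩, ?_⟩
      refine LinearMap.pi_ext' fun y => LinearMap.ext_ring (funext fun x => ?_)
      refine (IncidenceAlgebra.definingRep_single _ x y).trans ?_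
      change m.repr (b • m y) x = θ b (Pi.single y 1) x
      have : Pi.single y 1 = m.equivFun (m y) := by
        ext z; simp [Pi.single_apply, eq_comm]
      rw [this, hθ]
      rfl
    · rintro ⟨g, rfl⟩
      rw [← (IncidenceAlgebra.standardBasis K Q).sum_repr g]
      change IncidenceAlgebra.definingRep K Q _ ∈ _
      rw [map_sum]
      refine Subalgebra.sum_mem _ fun p _ => ?_
      rw [map_smul]
      refine Subalgebra.smul_mem _ ?_ _
      obtain ⟨⟨x, y⟩, h⟩ := p
      rw [IncidenceAlgebra.standardBasis_apply]
      obtain ⟨b, hb, hb0⟩ := hunits x y h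
      refine ⟨b, ?_⟩
      change θ b = _
      refine (m.map m.equivFun).ext fun z => ?_
      rw [Module.Basis.map_apply, hθ]
      ext a
      rw [IncidenceAlgebra.definingRep_elementary]
      by_cases hz : z = y
      · subst hz
        rw [hb]
        simp [eq_comm]
      · simp [hb0 z hz, hz]
  let ψ : B ≃ₐ[K] IncidenceAlgebra K Q := (AlgEquiv.ofInjective θ hinj).trans
    ((Subalgebra.equivOfEq _ _ (SetLike.ext hrange)).trans
      (AlgEquiv.ofInjective _ IncidenceAlgebra.definingRep_injective).symm)
  have hψ : ∀ b, IncidenceAlgebra.definingRep K Q (ψ b) = θ b := fun b => by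
    have := (AlgEquiv.ofInjective (IncidenceAlgebra.definingRep K Q)
      IncidenceAlgebra.definingRep_injective).apply_symm_apply
        (Subalgebra.equivOfEq _ _ (SetLike.ext hrange) (AlgEquiv.ofInjective θ hinj b))
    exact congrArg Subtype.val this
  exact ⟨ψ, fun b n => by rw [hψ, hθ]⟩

/-- Shared by both parts of the structure theorem: the idempotents are the coordinate projections of
the basis `m`, and the order is the support of the matrices of `B`. -/
theorem exists_basis_algEquiv_incidenceAlgebra (hf : ∀ b : B, (∀ n : M, b • n = 0) → b = 0)
    {e : Q → B} {m : Q → M} (hsum : ∀ n : M, ∑ x, e x • n = n) (hm : ∀ x, m x ≠ 0)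
    (hem : ∀ x y, e x • m y = if x = y then m x else 0)
    (hthin : ∀ x (n : M), ∃ k : K, e x • n = k • m x)
    (hle : ∀ x y, x ≤ y ↔ ∃ b : B, e x • b • m y ≠ 0) :
    ∃ (m' : Module.Basis Q K M) (ψ : B ≃ₐ[K] IncidenceAlgebra K Q), ∀ (b : B) (n : M),
      m'.equivFun (b • n) = IncidenceAlgebra.definingRep K Q (ψ b) (m'.equivFun n) := by
  have hcomm : ∀ (b : B) (k : K) (n : M), b • k • n = k • b • n := fun b k n => by
    rw [← algebraMap_smul B k n, smul_smul, ← Algebra.commutes, mul_smul, algebraMap_smul]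
  have hcoord : ∀ (c : Q → K) x, e x • ∑ y, c y • m y = c x • m x := by
    intro c x
    simp [Finset.smul_sum, hcomm, hem]
  have hli : LinearIndependent K m := by
    rw [Fintype.linearIndependent_iff]
    intro c hc x
    have := hcoord c x
    rw [hc, smul_zero, eq_comm, smul_eq_zero] at this
    exact this.resolve_right (hm x)
  have hsp : ⊤ ≤ Submodule.span K (Set.range m) := by
    intro n _
    rw [← hsum n]
    refine Submodule.sum_mem _ fun x _ => ?_
    obtain ⟨k, hk⟩ := hthin x n
    rw [hk]
    exact Submodule.smul_mem _ _ (Submodule.subset_span ⟨x, rfl⟩)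
  let m' := Module.Basis.mk hli hsp
  have hm' : ∀ x, m' x = m x := fun x => Module.Basis.mk_apply hli hsp x
  have hrepr : ∀ n x, e x • n = m'.repr n x • m x := by
    intro n x
    conv_lhs => rw [← m'.sum_repr n]
    simp only [hm']
    exact hcoord _ x
  refine ⟨m', exists_algEquiv_incidenceAlgebra hf m' (fun b x y h => ?_) fun x y h => ?_⟩
  · refine (hle x y).2 ⟨b, ?_⟩
    rw [← hm' y, hrepr]
    exact smul_ne_zero h (hm x)
  · obtain ⟨b, hb⟩ := (hle x y).1 h
    obtain ⟨k, hk⟩ := hthin x (b • m y)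
    have hk0 : k ≠ 0 := fun h0 => hb (by rw [hk, h0, zero_smul])
    -- Cutting `b` leaves only its entry `k` at `(x, y)`; rescaling gives the matrix unit.
    refine ⟨k⁻¹ • (e x * b * e y), ?_, fun z hz => ?_⟩
    · rw [hm', hm', smul_assoc, mul_smul, mul_smul, hem, if_pos rfl, hk, smul_smul,
        inv_mul_cancel₀ hk0, one_smul]
    · rw [hm', smul_assoc, mul_smul, hem, if_neg hz.symm, smul_zero, smul_zero]

end Criterion

/-! ### The poset of a thin module, and arbitrary presentations. -/

section Incidence

variable {K : Type w} [Field K] {B : Type u} [Ring B] [Algebra K B]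
  {M : Type v} [AddCommGroup M] [Module K M] [Module B M] [IsScalarTower K B M]

/-- The poset consists of the idempotents not killing `M`, with `x ≤ y` when some element of `B`
maps the line at `y` nontrivially to the line at `x`. Transitivity comes from thinness, antisymmetry
from `hc`. -/
theorem exists_poset_algEquiv_incidenceAlgebra (hf : ∀ b : B, (∀ n : M, b • n = 0) → b = 0)
    {r : ℕ} {e : Fin r → B} (he : CompleteOrthogonalIdempotents e)
    (ht : ∀ i, IsThinOn K M (e i))
    (hc : ∀ i j, i ≠ j → ∀ (a b : B) (n : M), e i • a • e j • b • e i • n = 0) :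
    ∃ (P : Type) (_ : PartialOrder P) (_ : Fintype P) (_ : DecidableEq P)
      (_ : LocallyFiniteOrder P) (m : Module.Basis P K M) (ψ : B ≃ₐ[K] IncidenceAlgebra K P),
      ∀ (b : B) (n : M),
        m.equivFun (b • n) = IncidenceAlgebra.definingRep K P (ψ b) (m.equivFun n) := by
  classical
  -- `P` is kept abstract, since a subtype of `Fin r` would bring its own, unrelated order.
  obtain ⟨P, _, g, hg, hgr⟩ : ∃ (P : Type) (_ : Fintype P) (g : P → Fin r),
      Function.Injective g ∧ ∀ i, (∃ n : M, e i • n ≠ 0) ↔ ∃ x, g x = i :=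
    ⟨{i : Fin r // ∃ n : M, e i • n ≠ 0}, inferInstance, Subtype.val, Subtype.val_injective,
      fun i => by simp⟩
  choose w hw using fun x : P => (hgr (g x)).2 ⟨x, rfl⟩
  let m : P → M := fun x => e (g x) • w x
  have hm : ∀ x, m x ≠ 0 := hw
  have hself : ∀ x, e (g x) • m x = m x := fun x => he.smul_smul_self _ _
  have hthin : ∀ (x : P) (n : M), ∃ k : K, e (g x) • n = k • m x := fun x n =>
    ht (g x) _ _ (hself x) (he.smul_smul_self _ n) (hm x)
  have hcomm : ∀ (b : B) (k : K) (n : M), b • k • n = k • b • n := fun b k n => by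
    rw [← algebraMap_smul B k n, smul_smul, ← Algebra.commutes, mul_smul, algebraMap_smul]
  have hprod : ∀ (x y z : P) (a b : B), e (g x) • a • m y ≠ 0 → e (g y) • b • m z ≠ 0 →
      e (g x) • a • e (g y) • b • m z ≠ 0 := by
    intro x y z a b h1 h2
    obtain ⟨k, hk⟩ := hthin y (b • m z)
    rw [hk] at h2 ⊢
    rw [hcomm, hcomm]
    exact smul_ne_zero (fun h0 => h2 (by rw [h0, zero_smul])) h1
  let _ : PartialOrder P :=
    { le := fun x y => ∃ b : B, e (g x) • b • m y ≠ 0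
      le_refl := fun x => ⟨1, by rw [one_smul, hself]; exact hm x⟩
      le_trans := fun x y z ⟨a, ha⟩ ⟨b, hb⟩ => ⟨a * e (g y) * b, by
        rw [mul_smul, mul_smul]; exact hprod x y z a b ha hb⟩
      le_antisymm := fun x y ⟨a, ha⟩ ⟨b, hb⟩ => by
        by_contra hxy
        exact hprod x y x a b ha hb (hc (g x) (g y) (fun h => hxy (hg h)) a b (w x)) }
  let _ : LocallyFiniteOrder P := Fintype.toLocallyFiniteOrder
  refine ⟨P, inferInstance, inferInstance, inferInstance, inferInstance,
    exists_basis_algEquiv_incidenceAlgebra (e := fun x : P => e (g x)) hf (fun n => ?_) hm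
      (fun x y => ?_) hthin fun x y => Iff.rfl⟩
  · conv_rhs => rw [← he.sum_smul n]
    refine Finset.sum_of_injOn g hg.injOn (by simp) (fun i _ hi => ?_) fun _ _ => rfl
    by_contra h0
    obtain ⟨x, rfl⟩ := (hgr i).1 ⟨n, h0⟩
    exact hi ⟨x, by simp, rfl⟩
  · split_ifs with hxy
    · rw [← hxy, hself]
    · change e (g x) • e (g y) • w y = 0
      rw [smul_smul, he.ortho fun h => hxy (hg h), zero_smul]

/-- If a faithful module is multiplicity free, then every presentation of the algebra as an
incidence algebra can be changed to one for which the module is the defining representation. -/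
theorem exists_basis_of_algEquiv_incidenceAlgebra {Q : Type x} [PartialOrder Q] [Fintype Q]
    [DecidableEq Q] [LocallyFiniteOrder Q] (hf : ∀ b : B, (∀ n : M, b • n = 0) → b = 0)
    (ht : ∀ e : B, (∀ b, ∃ k : K, e * b * e = k • e) → IsThinOn K M e)
    (ψ : B ≃ₐ[K] IncidenceAlgebra K Q) :
    ∃ (m : Module.Basis Q K M) (ψ' : B ≃ₐ[K] IncidenceAlgebra K Q), ∀ (b : B) (n : M),
      m.equivFun (b • n) = IncidenceAlgebra.definingRep K Q (ψ' b) (m.equivFun n) := by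
  let f : ∀ x y : Q, x ≤ y → B := fun x y h => ψ.symm (IncidenceAlgebra.elementary K x y h)
  let e : Q → B := fun x => f x x le_rfl
  have hff : ∀ {x y z : Q} (hxy : x ≤ y) (hyz : y ≤ z),
      f x y hxy * f y z hyz = f x z (hxy.trans hyz) := fun hxy hyz => by
    simp only [f]
    rw [← map_mul, IncidenceAlgebra.elementary_mul_elementary]
  have hf0 : ∀ {x y : Q} (h : x ≤ y), ∃ n : M, f x y h • n ≠ 0 := by
    intro x y h
    by_contra! h0
    have := hf _ h0
    rw [map_eq_zero_iff _ ψ.symm.injective] at this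
    exact IncidenceAlgebra.elementary_ne_zero h this
  have he : CompleteOrthogonalIdempotents e :=
    IncidenceAlgebra.completeOrthogonalIdempotents_elementary.map
      (ψ.symm : IncidenceAlgebra K Q →+* B)
  have hte : ∀ x, IsThinOn K M (e x) := fun x => ht _ fun b => ⟨ψ b x x, by
    apply ψ.injective
    simp only [e, f, map_mul, map_smul, AlgEquiv.apply_symm_apply]
    exact IncidenceAlgebra.elementary_mul_mul_elementary _ _⟩
  choose w hw using fun x : Q => hf0 (le_refl x)
  let m : Q → M := fun x => e x • w x
  have hm : ∀ x, m x ≠ 0 := hw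
  have hself : ∀ x, e x • m x = m x := fun x => he.smul_smul_self _ _
  have hthin : ∀ x (n : M), ∃ k : K, e x • n = k • m x := fun x n =>
    hte x _ _ (hself x) (he.smul_smul_self _ n) (hm x)
  refine exists_basis_algEquiv_incidenceAlgebra hf he.sum_smul hm (fun x y => ?_) hthin
    fun x y => ⟨fun hxy => ?_, fun ⟨b, hb⟩ => ?_⟩
  · split_ifs with hxy
    · rw [← hxy, hself]
    · change e x • e y • w y = 0
      rw [smul_smul, he.ortho hxy, zero_smul]
  -- By faithfulness `f x y hxy` acts nontrivially; it factors through the line of `m y`, so it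
  -- cannot kill `m y`.
  · refine ⟨f x y hxy, fun h0 => ?_⟩
    obtain ⟨n, hn⟩ := hf0 hxy
    obtain ⟨k, hk⟩ := hthin y n
    refine hn ?_
    rw [smul_smul, hff] at h0
    rw [← hff hxy le_rfl, mul_smul]
    change f x y hxy • e y • n = 0
    rw [hk, ← algebraMap_smul B k, smul_smul, ← Algebra.commutes, mul_smul, h0, smul_zero]
  · by_contra hxy
    refine hb ?_
    have : e x * b * e y = 0 := by
      apply ψ.injective
      simp only [e, f, map_mul, map_zero, AlgEquiv.apply_symm_apply]
      exact IncidenceAlgebra.elementary_mul_mul_elementary_of_not_le _ hxy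
    rw [← hself y, smul_smul, smul_smul, this, zero_smul]

end Incidence

/-! ### The main theorem. -/

theorem theorem4
    (K : Type w) [Field K] [Infinite K]
    (A : Type u) [Ring A] [Algebra K A] [Module.Finite K A]
    (hpointed : IsPointedAlgebra K A) (hacyclic : IsAcyclicAlgebra A)
    (M : Type v) [AddCommGroup M] [Module K M] [Module A M] [IsScalarTower K A M] :
    (IsDistributiveModule A M ↔ Finite (Submodule A M)) ∧
    (IsDistributiveModule A M ↔ Finite (MulAction.orbitRel.Quotient Aˣ M)) ∧
    (IsDistributiveModule A M →
      letI : Module (A ⧸ Module.annihilator A M) M := Module.quotientAnnihilator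
      (∃ (P : Type) (_ : PartialOrder P) (_ : Fintype P) (_ : DecidableEq P)
          (_ : LocallyFiniteOrder P)
          (ψ : (A ⧸ Module.annihilator A M) ≃ₐ[K] IncidenceAlgebra K P)
          (f : Module.Basis {p : P × P // p.1 ≤ p.2} K (A ⧸ Module.annihilator A M))
          (m : Module.Basis P K M),
        (∀ (x y : P) (hxy : x ≤ y),
          ψ (f ⟨(x, y), hxy⟩) = IncidenceAlgebra.elementary K x y hxy) ∧
        (∀ (x y : P) (hxy : x ≤ y), f ⟨(x, y), hxy⟩ • m y = m x) ∧
        (∀ (x y : P) (hxy : x ≤ y) (z : P), z ≠ y → f ⟨(x, y), hxy⟩ • m z = 0) ∧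
        (∀ (b : A ⧸ Module.annihilator A M) (n : M),
          m.equivFun (b • n) = IncidenceAlgebra.definingRep K P (ψ b) (m.equivFun n))) ∧
      (∀ (Q : Type x) [PartialOrder Q] [Fintype Q] [DecidableEq Q] [LocallyFiniteOrder Q]
          (ψ : (A ⧸ Module.annihilator A M) ≃ₐ[K] IncidenceAlgebra K Q),
        ∃ (φ : (A ⧸ Module.annihilator A M) ≃ₐ[K] (A ⧸ Module.annihilator A M))
          (L : M ≃ₗ[K] (Q → K)),
          ∀ (b : A ⧸ Module.annihilator A M) (n : M),
            L (φ b • n) = IncidenceAlgebra.definingRep K Q (ψ b) (L n))) := by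
  obtain ⟨r, χ, e, h⟩ := hpointed.exists_splitIdempotents
  have hcorner : ∀ i (a : A), ∃ k : K, ∀ n : M, e i • a • e i • n = k • e i • n := fun i a =>
    ⟨χ i a, fun n => by rw [smul_smul, smul_smul, h.corner hacyclic, smul_assoc]⟩
  have hiff : IsDistributiveModule A M ↔ Finite (Submodule A M) :=
    ⟨fun hd => finite_submodule_of_isThinOn h.complete fun i => hd.isThinOn (hcorner i),
      fun _ => isDistributiveModule_of_isThinOn (K := K) h.complete fun i =>
        isThinOn_of_finite_submodule (hcorner i)⟩
  refine ⟨hiff, hiff.trans ⟨fun _ => h.finite_orbits, fun _ => finite_submodule_of_finite_orbits⟩,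
    fun hd => ?_⟩
  let _ : Module (A ⧸ Module.annihilator A M) M := Module.quotientAnnihilator
  have hmk : ∀ (a : A) (n : M), (Ideal.Quotient.mk (Module.annihilator A M) a) • n = a • n :=
    fun _ _ => rfl
  have : IsScalarTower K (A ⧸ Module.annihilator A M) M := ⟨fun k b n => by
    obtain ⟨a, rfl⟩ := Ideal.Quotient.mk_surjective b
    change Ideal.Quotient.mk (Module.annihilator A M) (k • a) • n = _
    rw [hmk, hmk, smul_assoc]⟩
  have hf : ∀ b : A ⧸ Module.annihilator A M, (∀ n : M, b • n = 0) → b = 0 := by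
    intro b hb
    obtain ⟨a, rfl⟩ := Ideal.Quotient.mk_surjective b
    exact Ideal.Quotient.eq_zero_iff_mem.2 (Module.mem_annihilator.2 hb)
  -- Distributivity forces thinness for every element with scalar corner, not only for the chosen
  -- idempotents; this is what admits an arbitrary `ψ`.
  have ht : ∀ e : A ⧸ Module.annihilator A M, (∀ b, ∃ k : K, e * b * e = k • e) →
      IsThinOn K M e := by
    intro e he
    obtain ⟨a, rfl⟩ := Ideal.Quotient.mk_surjective e
    refine hd.isThinOn (e := a) fun c => ?_
    obtain ⟨k, hk⟩ := he (Ideal.Quotient.mk _ c)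
    refine ⟨k, fun n => ?_⟩
    have := congrArg (fun b => b • n) hk
    simpa only [mul_smul, smul_assoc, hmk] using this
  refine ⟨?_, fun Q _ _ _ _ ψ => ?_⟩
  · obtain ⟨P, i1, i2, i3, i4, m, ψ, hψ⟩ := exists_poset_algEquiv_incidenceAlgebra (K := K) hf
      (e := fun i => Ideal.Quotient.mk (Module.annihilator A M) (e i))
      (h.complete.map (Ideal.Quotient.mk (Module.annihilator A M)))
      (fun i => hd.isThinOn (hcorner i)) (fun i j hij a b n => by
        obtain ⟨a, rfl⟩ := Ideal.Quotient.mk_surjective a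
        obtain ⟨b, rfl⟩ := Ideal.Quotient.mk_surjective b
        simp only [hmk, smul_smul, ← mul_assoc]
        rw [h.corner_mul_corner hacyclic hij, zero_smul])
    have hbasis : ∀ (x y : P) (hxy : x ≤ y),
        ψ ((IncidenceAlgebra.standardBasis K P).map ψ.symm.toLinearEquiv ⟨(x, y), hxy⟩) =
          IncidenceAlgebra.elementary K x y hxy := fun x y hxy => by
      rw [Module.Basis.map_apply, IncidenceAlgebra.standardBasis_apply]
      exact ψ.apply_symm_apply _
    refine ⟨P, i1, i2, i3, i4, ψ, (IncidenceAlgebra.standardBasis K P).map ψ.symm.toLinearEquiv, m,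
      hbasis, fun x y hxy => ?_, fun x y hxy z hz => ?_, hψ⟩
    · refine m.equivFun.injective (funext fun a => ?_)
      rw [hψ, hbasis, IncidenceAlgebra.definingRep_elementary]
      simp [eq_comm]
    · refine m.equivFun.injective (funext fun a => ?_)
      rw [hψ, hbasis, IncidenceAlgebra.definingRep_elementary]
      simp [hz]
  · obtain ⟨m, ψ', hψ'⟩ := exists_basis_of_algEquiv_incidenceAlgebra hf ht ψ
    -- With `φ` equal to `ψ` followed by the inverse of `ψ'`, the action of `φ b` has matrix `ψ' (φ
    -- b) = ψ b`.
    refine ⟨ψ.trans ψ'.symm, m.equivFun, fun b n => ?_⟩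
    rw [hψ', AlgEquiv.trans_apply, AlgEquiv.apply_symm_apply]
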